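/- Let $\mathcal{H}_1$ be the subring of the field $\mathbb{C}(z,\sigma)$ (with $z,\sigma$ independent indeterminates) consisting of all $q=p\,\phi^{-1}$ with $p\in\mathbb{C}[z,\sigma,\sigma^{-1}]$ and $0\neq\phi\in\mathbb{C}[z]$ such that the meromorphic function $q^*(z)=p(z,e^z)/\phi(z)$, obtained by substituting $\sigma\mapsto e^z$, extends to an entire function on $\mathbb{C}$. For an integer $n\ge 1$ let $\mathcal{H}_n=\mathcal{H}_1[z_2,\dots,z_n]$ be the polynomial ring over $\mathcal{H}_1$ in the $n-1$ indeterminates $z_2,\dots,z_n$ (so for $n=1$ it is $\mathcal{H}_1$ itself). **Theorem.** For every $n\ge 1$, $$\operatorname{gl.dim}\mathcal{H}_n\le n+1,$$ that is, every $\mathcal{H}_n$-module has projective dimension at most $n+1$. -/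

import Mathlib

open Polynomial LaurentPolynomial CategoryTheory

noncomputable section

namespace GeneralizedDD

/-- Substitution `σ ↦ e^z` at a point: for `p ∈ ℂ[z, σ, σ⁻¹]` (Laurent polynomials in `σ` with
coefficients in `ℂ[z]`), the number `p(w, e^w)`. -/
def expEval (w : ℂ) : ℂ[X][T;T⁻¹] →+* ℂ :=
  LaurentPolynomial.eval₂ (Polynomial.evalRingHom w) (Units.mk0 (Complex.exp w) (Complex.exp_ne_zero w))

@[simp] lemma expEval_C (w : ℂ) (φ : ℂ[X]) : expEval w (LaurentPolynomial.C φ) = φ.eval w := by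
  simp [expEval]

@[simp] lemma expEval_T (w : ℂ) (k : ℤ) :
    expEval w (LaurentPolynomial.T k) = Complex.exp w ^ k := by
  simp [expEval]

/-- The field `ℂ(z, σ)`, as the field of fractions of `ℂ[z, σ, σ⁻¹]`. -/
abbrev RatField : Type := FractionRing ℂ[X][T;T⁻¹]

/-- `q ∈ ℂ(z, σ)` can be written `q = p / φ` with `p ∈ ℂ[z, σ, σ⁻¹]` and `0 ≠ φ ∈ ℂ[z]`, and the
meromorphic function `q^*(w) = p(w, e^w) / φ(w)` extends to an entire function `f`. -/
def IsGeneralizedDD (q : RatField) : Prop :=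
  ∃ (p : ℂ[X][T;T⁻¹]) (φ : ℂ[X]), φ ≠ 0 ∧
    q = algebraMap ℂ[X][T;T⁻¹] RatField p /
      algebraMap ℂ[X][T;T⁻¹] RatField (LaurentPolynomial.C φ) ∧
    ∃ f : ℂ → ℂ, Differentiable ℂ f ∧ ∀ w : ℂ, φ.eval w ≠ 0 → f w = expEval w p / φ.eval w

lemma algebraMap_C_ne_zero {φ : ℂ[X]} (hφ : φ ≠ 0) :
    algebraMap ℂ[X][T;T⁻¹] RatField (LaurentPolynomial.C φ) ≠ 0 := by
  intro h
  rw [← map_zero (algebraMap ℂ[X][T;T⁻¹] RatField)] at h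
  have h0 := IsFractionRing.injective ℂ[X][T;T⁻¹] RatField h
  refine hφ (Polynomial.funext fun w => ?_)
  rw [← expEval_C, h0, map_zero, eval_zero]

lemma isGeneralizedDD_of_laurent (p : ℂ[X][T;T⁻¹])
    (hp : Differentiable ℂ fun w => expEval w p) :
    IsGeneralizedDD (algebraMap ℂ[X][T;T⁻¹] RatField p) :=
  ⟨p, 1, one_ne_zero, by simp, _, hp, by simp⟩

/-- The ring `ℋ = ℋ₁` of generalized delay-differential operators, as a subring of `ℂ(z, σ)`. -/
def H1 : Subring RatField where
  carrier := {q | IsGeneralizedDD q}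
  zero_mem' := by
    have := isGeneralizedDD_of_laurent 0 (by simp)
    rwa [map_zero] at this
  one_mem' := by
    have := isGeneralizedDD_of_laurent 1 (by simp)
    rwa [map_one] at this
  add_mem' := by
    rintro _ _ ⟨p, φ, hφ, rfl, f, hf, hfp⟩ ⟨p', φ', hφ', rfl, f', hf', hfp'⟩
    refine ⟨p * LaurentPolynomial.C φ' + p' * LaurentPolynomial.C φ, φ * φ',
      mul_ne_zero hφ hφ', ?_, _, hf.add hf', ?_⟩
    · have h := algebraMap_C_ne_zero hφ
      have h' := algebraMap_C_ne_zero hφ'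
      simp only [map_add, map_mul]
      field_simp
    · intro w hw
      simp only [eval_mul, ne_eq, mul_eq_zero, not_or] at hw
      obtain ⟨h, h'⟩ := hw
      simp only [Pi.add_apply, hfp w h, hfp' w h', map_add, map_mul, expEval_C, eval_mul]
      field_simp
  mul_mem' := by
    rintro _ _ ⟨p, φ, hφ, rfl, f, hf, hfp⟩ ⟨p', φ', hφ', rfl, f', hf', hfp'⟩
    refine ⟨p * p', φ * φ', mul_ne_zero hφ hφ', ?_, _, hf.mul hf', ?_⟩
    · simp only [map_mul]
      rw [div_mul_div_comm]
    · intro w hw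
      simp only [eval_mul, ne_eq, mul_eq_zero, not_or] at hw
      obtain ⟨h, h'⟩ := hw
      simp only [Pi.mul_apply, hfp w h, hfp' w h', map_mul, eval_mul]
      rw [div_mul_div_comm]
  neg_mem' := by
    rintro _ ⟨p, φ, hφ, rfl, f, hf, hfp⟩
    refine ⟨-p, φ, hφ, ?_, _, hf.neg, ?_⟩
    · rw [map_neg]
      exact (neg_div _ _).symm
    · intro w hw
      rw [Pi.neg_apply, hfp w hw, map_neg, neg_div]

/-- The ring `ℋₙ = ℋ₁[z₂, …, zₙ]` (for `n ≥ 1`), a polynomial ring in `n - 1` indeterminates. -/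
abbrev H (n : ℕ) : Type := MvPolynomial (Fin (n - 1)) H1

/-- The (left) global dimension of a ring: the supremum of the projective dimensions of all
its (left) modules, here those whose underlying type lives in the universe `max u v`. -/
def globalDimension.{v, u} (R : Type u) [Ring R] : WithBot ℕ∞ :=
  ⨆ M : ModuleCat.{max u v} R, projectiveDimension M

end GeneralizedDD

end

universe v

/-! By Auslander's theorem, bounding the projective dimension of every ideal of `H1` by 1 bounds
that of every module by 2; each polynomial variable then adds at most 1 (Hilbert), giving 2 + (n -
1) = n + 1.

To bound a nonzero ideal I of `H1`, invert ℂ[z] \ {0}: the ring becomes ℂ(z)[σ, σ⁻¹], a principal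
ideal domain, so some d = p(z, σ) in I divides every element of I up to a factor from ℂ[z]
(`exists_generator`). Taking values of q* at points gives `H1` = ℂ[z] + s `H1` for every nonzero s
in ℂ[z] (`exists_eq_ofPoly_add_mul`). With Bézout in ℂ[z], this shows that I is the directed union
of the principal ideals generated by its elements d/s, s monic. The roots of such s are zeros of
p(w, e^w), a nonzero entire function, so only countably many s occur (`countable_monic_dvd`). A
countable directed union of nonzero principal ideals has a free resolution of length 1, the
telescope. -/

section

open Abelian

universe u

/-! ### Baer's criterion and Auslander's theorem -/

section Homological

variable {R : Type u} [CommRing R]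

/-- The short complex `0 → I → R → R ⧸ I → 0` in any universe where `R` is small. -/
noncomputable def Ideal.shrinkShortComplex [Small.{v} R] (I : Ideal R) :
    ShortComplex (ModuleCat.{v} R) :=
  let f : Shrink.{v} I →ₗ[R] Shrink.{v} R :=
    (Shrink.linearEquiv R R).symm.toLinearMap ∘ₗ I.subtype ∘ₗ (Shrink.linearEquiv R I).toLinearMap
  ShortComplex.mk (ModuleCat.ofHom f) (ModuleCat.ofHom f.range.mkQ) (by ext x; simp)

lemma Ideal.shortExact_shrinkShortComplex [Small.{v} R] (I : Ideal R) :
    I.shrinkShortComplex.ShortExact :=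
  ModuleCat.shortComplex_shortExact _ (LinearMap.exact_map_mkQ_range _)
    ((Shrink.linearEquiv R R).symm.injective.comp
      (Subtype.val_injective.comp (Shrink.linearEquiv R I).injective))
    (Submodule.mkQ_surjective _)

/-- **Baer's criterion** in higher degrees. -/
lemma ModuleCat.hasInjectiveDimensionLE_of_ideal [Small.{v} R] (n : ℕ) (Y : ModuleCat.{v} R)
    (h : ∀ I : Ideal R, Subsingleton (Ext I.shrinkShortComplex.X₃ Y (n + 1))) :
    HasInjectiveDimensionLE Y n := by
  induction n generalizing Y with
  | zero =>
    have : Module.Injective R Y := by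
      apply Module.Baer.injective
      intro I g
      let g' : I.shrinkShortComplex.X₁ ⟶ Y :=
        ModuleCat.ofHom (g ∘ₗ (Shrink.linearEquiv R I).toLinearMap)
      have := h I
      -- The obstruction to extending `g` from I to R lies in Ext¹(R/I, Y) = 0.
      obtain ⟨x, hx⟩ := Ext.contravariant_sequence_exact₁ I.shortExact_shrinkShortComplex Y
        (Ext.mk₀ g') (n₁ := 1) rfl (Subsingleton.elim _ _)
      obtain ⟨φ, rfl⟩ := Ext.homEquiv₀.symm.surjective x
      have hφ : I.shrinkShortComplex.f ≫ φ = g' :=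
        Ext.homEquiv₀.symm.injective (by simpa using hx)
      refine ⟨φ.hom ∘ₗ (Shrink.linearEquiv R R).symm.toLinearMap, fun x hxI => ?_⟩
      let y := (Shrink.linearEquiv R I).symm ⟨x, hxI⟩
      have : φ.hom ((Shrink.linearEquiv R R).symm (I.subtype (Shrink.linearEquiv R I y))) =
        g (Shrink.linearEquiv R I y) := congr($(hφ).hom y)
      rwa [LinearEquiv.apply_symm_apply] at this
    have := Module.injective_object_of_injective_module R Y
    rw [HasInjectiveDimensionLE, zero_add, ← injective_iff_hasInjectiveDimensionLT_one]
    exact this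
  | succ n ih =>
    obtain ⟨⟨E, hE, f, hf⟩⟩ := (inferInstance : EnoughInjectives (ModuleCat.{v} R)).1 Y
    let T := ShortComplex.mk f (Limits.cokernel.π f) (Limits.cokernel.condition f)
    have hT : T.ShortExact := { exact := ShortComplex.exact_cokernel f }
    refine (hT.hasInjectiveDimensionLT_X₃_iff n hE).mp (ih _ fun I => ?_)
    -- Dimension shift: as E is injective, Extⁿ⁺¹(R/I, E/Y) embeds in Extⁿ⁺²(R/I, Y) = 0.
    have := h I
    refine subsingleton_of_forall_eq 0 fun x => ?_
    obtain ⟨y, rfl⟩ := Ext.covariant_sequence_exact₃ _ hT x rfl (Subsingleton.elim _ _)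
    rw [Ext.eq_zero_of_injective y, Ext.zero_comp]

/-- **Auslander's theorem**: ideals of projective dimension at most `n` force all modules to have
projective dimension at most `n + 1`. -/
theorem ModuleCat.hasProjectiveDimensionLE_succ_of_ideal [Small.{v} R] (n : ℕ)
    (h : ∀ I : Ideal R, HasProjectiveDimensionLE (ModuleCat.of R I) n) (M : ModuleCat.{v} R) :
    HasProjectiveDimensionLE M (n + 1) := by
  -- It suffices to bound the injective dimension of every Y, which by Baer is tested on the
  -- quotients R/I alone.
  refine hasProjectiveDimensionLT_of_enoughInjectives M (n + 2) fun Y => ?_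
  have : HasInjectiveDimensionLE Y (n + 1) := by
    refine hasInjectiveDimensionLE_of_ideal _ Y fun I => ?_
    have := h I
    have h₁ : HasProjectiveDimensionLE I.shrinkShortComplex.X₁ n :=
      hasProjectiveDimensionLE_of_linearEquiv (M := ModuleCat.of R I)
        (N := ModuleCat.of R (Shrink.{v} I)) (Shrink.linearEquiv R I).symm n
    have h₂ : Projective I.shrinkShortComplex.X₂ :=
      ModuleCat.projective_of_free (M := ModuleCat.of R (Shrink.{v} R))
        (Module.Basis.singleton Unit R |>.map (Shrink.linearEquiv R R).symm)
    have := (I.shortExact_shrinkShortComplex.hasProjectiveDimensionLT_X₃_iff n h₂).mpr h₁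
    exact HasProjectiveDimensionLT.subsingleton _ (n + 2) _ le_rfl Y
  exact HasInjectiveDimensionLT.subsingleton _ (n + 2) _ le_rfl M

end Homological

/-! ### Hilbert's syzygy theorem -/

section PolynomialModule

namespace PolynomialModule

section

variable {R : Type u} [CommRing R] {M N : Type v} [AddCommGroup M] [Module R M]
  [AddCommGroup N] [Module R N]

/-- The map of polynomial modules induced by a linear map of the coefficients. -/
noncomputable def mapLinear (f : M →ₗ[R] N) :
    PolynomialModule R M →ₗ[R[X]] PolynomialModule R N where
  toFun := map R f
  map_add' := map_add _
  map_smul' p q := by simpa using PolynomialModule.map_smul R f p q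

lemma coeff_mapLinear (f : M →ₗ[R] N) (q : PolynomialModule R M) (n : ℕ) :
    (mapLinear f q).coeff n = f (q.coeff n) := by
  rfl

lemma mapLinear_injective {f : M →ₗ[R] N} (hf : Function.Injective f) :
    Function.Injective (mapLinear f) := by
  rw [injective_iff_map_eq_zero]
  intro q hq
  apply coeff_injective
  ext n
  apply hf
  rw [← coeff_mapLinear, hq]
  simp

lemma mapLinear_surjective {f : M →ₗ[R] N} (hf : Function.Surjective f) :
    Function.Surjective (mapLinear f) := by
  intro q
  induction q using induction_linear with
  | zero => exact ⟨0, map_zero _⟩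
  | add p q hp hq =>
    obtain ⟨a, rfl⟩ := hp
    obtain ⟨b, rfl⟩ := hq
    exact ⟨a + b, map_add _ _ _⟩
  | single n m =>
    obtain ⟨a, rfl⟩ := hf m
    exact ⟨single R n a, map_single R f n a⟩

lemma mapLinear_exact {P : Type v} [AddCommGroup P] [Module R P] {f : M →ₗ[R] N} {g : N →ₗ[R] P}
    (h : Function.Exact f g) : Function.Exact (mapLinear f) (mapLinear g) := by
  intro q
  constructor
  · intro hq
    have hq' (n : ℕ) : ∃ m, f m = q.coeff n := by
      rw [← Set.mem_range, ← h, ← coeff_mapLinear, hq]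
      simp
    choose m hm using hq'
    classical
    -- Zero coefficients must be lifted to 0 to keep the support finite.
    refine ⟨ofCoeff R (Finsupp.onFinset q.coeff.support
      (fun n => if q.coeff n = 0 then 0 else m n) (by simp +contextual)), ?_⟩
    apply coeff_injective
    ext n
    rw [coeff_mapLinear, coeff_ofCoeff, Finsupp.onFinset_apply]
    split_ifs with h0 <;> simp [h0, hm]
  · rintro ⟨p, rfl⟩
    apply coeff_injective
    ext n
    simp [coeff_mapLinear, h.apply_apply_eq_zero]

lemma X_smul_single (n : ℕ) (m : M) :
    (X : R[X]) • single R n m = single R (n + 1) m := by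
  rw [← monomial_one_one_eq_X, monomial_smul_single, one_smul, add_comm]

instance [Module.Projective R M] : Module.Projective R[X] (PolynomialModule R M) :=
  Module.Projective.of_equiv (polynomialTensorProductLEquivPolynomialModule R M)

end

section

variable {R : Type u} [CommRing R] {M : Type v} [AddCommGroup M] [Module R M] [Module R[X] M]
  [IsScalarTower R R[X] M]

variable (R M) in
/-- Multiplication by `X` on an `R[X]`-module, as an `R`-linear map. -/
noncomputable def smulX : M →ₗ[R] M := (LinearMap.lsmul R[X] M X).restrictScalars R

@[simp] lemma smulX_apply (m : M) : smulX R M m = (X : R[X]) • m := rfl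

variable (R M) in
/-- The endomorphism of `R[X] ⊗ M` sending `1 ⊗ m` to `X ⊗ m - 1 ⊗ X m`. -/
noncomputable def subSmulX : PolynomialModule R M →ₗ[R[X]] PolynomialModule R M :=
  LinearMap.lsmul R[X] _ X - mapLinear (smulX R M)

lemma subSmulX_single (n : ℕ) (m : M) :
    subSmulX R M (single R n m) = single R (n + 1) m - single R n ((X : R[X]) • m) := by
  simp [subSmulX, X_smul_single, mapLinear]

lemma coeff_subSmulX (q : PolynomialModule R M) (n : ℕ) :
    (subSmulX R M q).coeff (n + 1) = q.coeff n - (X : R[X]) • q.coeff (n + 1) := by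
  have h : ((X : R[X]) • q).coeff (n + 1) = q.coeff n := by
    rw [← monomial_one_one_eq_X, monomial_smul_apply]; simp
  have h' : subSmulX R M q + mapLinear (smulX R M) q = (X : R[X]) • q := sub_add_cancel _ _
  rw [eq_sub_iff_add_eq, ← h, ← h', coeff_add, Finsupp.add_apply, coeff_mapLinear, smulX_apply]

/-- In the kernel each coefficient is X times the next one, hence a power of X times a coefficient
beyond the support. -/
lemma subSmulX_injective : Function.Injective (subSmulX R M) := by
  rw [injective_iff_map_eq_zero]
  intro q hq
  have h (n : ℕ) : q.coeff n = (X : R[X]) • q.coeff (n + 1) := by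
    rw [← sub_eq_zero, ← coeff_subSmulX, hq]; simp
  have h' (k n : ℕ) : q.coeff n = (X : R[X]) ^ k • q.coeff (n + k) := by
    induction k with
    | zero => simp
    | succ k ih => rw [ih, h, pow_succ, mul_smul]; rfl
  obtain ⟨N, hN⟩ := q.coeff.support.exists_nat_subset_range
  apply coeff_injective
  ext n
  rw [h' N n, Finsupp.notMem_support_iff.mp fun hn => ?_, smul_zero]
  · rfl
  · simpa using hN hn

variable (R M) in
/-- The counit `R[X] ⊗ M → M`, sending `Xⁿ ⊗ m` to `Xⁿ m`. -/
noncomputable def actionMap : PolynomialModule R M →ₗ[R[X]] M where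
  toFun q := q.coeff.sum fun n m => (X : R[X]) ^ n • m
  map_add' p q := Finsupp.sum_add_index' (by simp) (by simp)
  map_smul' p q := by
    have hs (n : ℕ) (m : M) : ((single R n m).coeff.sum fun n m => (X : R[X]) ^ n • m) =
        (X : R[X]) ^ n • m := Finsupp.sum_single_index (by simp)
    have ha (p q : PolynomialModule R M) :
        ((p + q).coeff.sum fun n m => (X : R[X]) ^ n • m) =
          (p.coeff.sum fun n m => (X : R[X]) ^ n • m) +
            q.coeff.sum fun n m => (X : R[X]) ^ n • m := Finsupp.sum_add_index' (by simp) (by simp)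
    rw [RingHom.id_apply]
    induction q using induction_linear with
    | zero => simp
    | add q r hq hr => rw [smul_add, ha, hq, hr, ha, smul_add]
    | single n m =>
      induction p using Polynomial.induction_on' with
      | add _ _ h₁ h₂ => rw [add_smul, ha, h₁, h₂, add_smul]
      | monomial k r =>
        rw [monomial_smul_single, hs, hs, ← C_mul_X_pow_eq_monomial, smul_smul, mul_assoc,
          ← pow_add, ← smul_one_smul R[X] r m, smul_smul,
          Polynomial.smul_eq_C_mul, mul_one, mul_comm]

lemma actionMap_single (n : ℕ) (m : M) :
    actionMap R M (single R n m) = (X : R[X]) ^ n • m :=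
  Finsupp.sum_single_index (by simp)

lemma actionMap_surjective : Function.Surjective (actionMap R M) :=
  fun m => ⟨single R 0 m, by simp [actionMap_single]⟩

/-- Modulo the range, Xⁿ⁺¹ ⊗ m equals Xⁿ ⊗ Xm, so all powers of X can be moved into the coefficient.
-/
lemma sub_single_actionMap_mem_range (q : PolynomialModule R M) :
    q - single R 0 (actionMap R M q) ∈ (subSmulX R M).range := by
  induction q using induction_linear with
  | zero => simp
  | add p q hp hq =>
    convert add_mem hp hq using 1
    rw [map_add, single_add]
    abel
  | single n m =>
    rw [actionMap_single]
    induction n generalizing m with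
    | zero => simp
    | succ n ih =>
      convert add_mem (ih ((X : R[X]) • m)) ⟨single R n m, rfl⟩ using 1
      rw [subSmulX_single, smul_smul, ← pow_succ]
      abel

lemma subSmulX_actionMap_exact : Function.Exact (subSmulX R M) (actionMap R M) := by
  intro q
  constructor
  · intro hq
    simpa [hq] using sub_single_actionMap_mem_range q
  · rintro ⟨p, rfl⟩
    induction p using induction_linear with
    | zero => simp
    | add p q hp hq => rw [map_add, map_add, hp, hq, add_zero]
    | single n m => simp [subSmulX_single, actionMap_single, smul_smul, pow_succ]

end

end PolynomialModule

namespace ModuleCat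

variable {R : Type u} [CommRing R]

lemma hasProjectiveDimensionLE_succ_of_exact {A B C : Type v} [AddCommGroup A] [AddCommGroup B]
    [AddCommGroup C] [Module R A] [Module R B] [Module R C] {f : A →ₗ[R] B} {g : B →ₗ[R] C}
    (h : Function.Exact f g) (hf : Function.Injective f) (hg : Function.Surjective g) (n : ℕ)
    (hA : HasProjectiveDimensionLE (ModuleCat.of R A) n)
    (hB : HasProjectiveDimensionLE (ModuleCat.of R B) (n + 1)) :
    HasProjectiveDimensionLE (ModuleCat.of R C) (n + 1) :=
  (shortComplex_shortExact (ModuleCat.shortComplexOfCompEqZero f g h.linearMap_comp_eq_zero)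
    h hf hg).hasProjectiveDimensionLT_X₃ (n + 1) hA hB

lemma hasProjectiveDimensionLE_of_projective (P : Type v) [AddCommGroup P] [Module R P]
    [Module.Projective R P] (n : ℕ) : HasProjectiveDimensionLE (ModuleCat.of R P) n :=
  hasProjectiveDimensionLT_of_ge _ 1 _ (by lia)

/-- R[X] ⊗ - is exact and preserves projectives, so it carries resolutions to resolutions. -/
lemma hasProjectiveDimensionLE_polynomialModule [Small.{v} R] [Small.{v} R[X]] (n : ℕ)
    (M : ModuleCat.{v} R) [HasProjectiveDimensionLE M n] :
    HasProjectiveDimensionLE (ModuleCat.of R[X] (PolynomialModule R M)) n := by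
  induction n generalizing M with
  | zero =>
    have : HasProjectiveDimensionLE M 0 := ‹_›
    simp only [HasProjectiveDimensionLE, zero_add] at this ⊢
    rw [← projective_iff_hasProjectiveDimensionLT_one, ← IsProjective.iff_projective] at this ⊢
    infer_instance
  | succ n ih =>
    have hS : M.projectiveShortComplex.ShortExact := M.shortExact_projectiveShortComplex
    have := (hS.hasProjectiveDimensionLT_X₃_iff n inferInstance).mp ‹_›
    exact hasProjectiveDimensionLE_succ_of_exact
      (PolynomialModule.mapLinear_exact
        ((ShortComplex.ShortExact.moduleCat_exact_iff_function_exact _).mp hS.exact))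
      (PolynomialModule.mapLinear_injective hS.moduleCat_injective_f)
      (PolynomialModule.mapLinear_surjective hS.moduleCat_surjective_g) n
      (ih M.projectiveShortComplex.X₁) (hasProjectiveDimensionLE_of_projective _ _)

/-- **Hilbert's syzygy theorem**, in terms of bounds on the projective dimension of all modules. -/
theorem hasProjectiveDimensionLE_polynomial [Small.{v} R] [Small.{v} R[X]] (n : ℕ)
    (h : ∀ M : ModuleCat.{v} R, HasProjectiveDimensionLE M n) (M : ModuleCat.{v} R[X]) :
    HasProjectiveDimensionLE M (n + 1) := by
  let : Module R M := Module.compHom M (C : R →+* R[X])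
  have : IsScalarTower R R[X] M := ⟨fun r p m => by
    rw [Polynomial.smul_eq_C_mul, mul_smul]; rfl⟩
  have := h (ModuleCat.of R M)
  have := hasProjectiveDimensionLE_polynomialModule n (ModuleCat.of R M)
  -- The sequence 0 → R[X] ⊗ M → R[X] ⊗ M → M → 0 costs one dimension.
  exact hasProjectiveDimensionLE_succ_of_exact PolynomialModule.subSmulX_actionMap_exact
    PolynomialModule.subSmulX_injective PolynomialModule.actionMap_surjective n this
    (hasProjectiveDimensionLT_of_ge _ (n + 1) _ (by lia))

theorem hasProjectiveDimensionLE_of_ringEquiv {R' : Type u} [CommRing R'] [Small.{v} R]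
    [Small.{v} R'] (e : R ≃+* R') (n : ℕ)
    (h : ∀ M : ModuleCat.{v} R, HasProjectiveDimensionLE M n) (M : ModuleCat.{v} R') :
    HasProjectiveDimensionLE M n := by
  have := RingHomInvPair.of_ringEquiv e
  have := RingHomInvPair.symm (RingHomClass.toRingHom e) (RingHomClass.toRingHom e.symm)
  let : Module R M := Module.compHom M e.toRingHom
  have := h (ModuleCat.of R M)
  exact hasProjectiveDimensionLE_of_semiLinearEquiv (M := ModuleCat.of R M) (N := M) e
    { toFun := id, invFun := id, map_add' := fun _ _ => rfl, map_smul' := fun _ _ => rfl,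
      left_inv := fun _ => rfl, right_inv := fun _ => rfl } n

theorem hasProjectiveDimensionLE_mvPolynomial [Small.{v} R]
    [∀ k, Small.{v} (MvPolynomial (Fin k) R)] (n : ℕ)
    (h : ∀ M : ModuleCat.{v} R, HasProjectiveDimensionLE M n) (k : ℕ)
    (M : ModuleCat.{v} (MvPolynomial (Fin k) R)) : HasProjectiveDimensionLE M (n + k) := by
  induction k with
  | zero =>
    exact hasProjectiveDimensionLE_of_ringEquiv (MvPolynomial.isEmptyRingEquiv R (Fin 0)).symm n h M
  | succ k ih =>
    have e := (MvPolynomial.finSuccEquiv R k).toRingEquiv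
    have : Small.{v} (MvPolynomial (Fin k) R)[X] := small_of_injective e.symm.injective
    exact hasProjectiveDimensionLE_of_ringEquiv e.symm _
      (hasProjectiveDimensionLE_polynomial _ ih) M

end ModuleCat

end PolynomialModule

/-! ### Telescope resolution of an increasing union of principal ideals -/

section Telescope

variable {R : Type u} [CommRing R] (c : ℕ → R)

/-- The telescope endomorphism of `R^(ℕ)` of the sequence of maps `c n : R → R`. -/
noncomputable def telescopeMap : (ℕ →₀ R) →ₗ[R] (ℕ →₀ R) :=
  Finsupp.linearCombination R fun n => Finsupp.single n 1 - Finsupp.single (n + 1) (c n)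

lemma telescopeMap_single (n : ℕ) (r : R) : telescopeMap c (Finsupp.single n r) =
    Finsupp.single n r - Finsupp.single (n + 1) (r * c n) := by
  simp [telescopeMap, smul_sub]

lemma telescopeMap_apply_zero (x : ℕ →₀ R) : telescopeMap c x 0 = x 0 := by
  induction x using Finsupp.induction_linear with
  | zero => simp
  | add x y hx hy => simp [hx, hy]
  | single n r => simp [telescopeMap_single]

lemma telescopeMap_apply_succ (x : ℕ →₀ R) (n : ℕ) :
    telescopeMap c x (n + 1) = x (n + 1) - x n * c n := by
  induction x using Finsupp.induction_linear with
  | zero => simp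
  | add x y hx hy => simp [hx, hy]; ring
  | single k r =>
    rw [telescopeMap_single]
    simp only [Finsupp.coe_sub, Pi.sub_apply, Finsupp.single_apply, Nat.add_right_cancel_iff]
    split_ifs with h₁ h₂ <;> simp_all

lemma telescopeMap_injective : Function.Injective (telescopeMap c) := by
  rw [injective_iff_map_eq_zero]
  intro x hx
  ext n
  induction n with
  | zero => rw [← telescopeMap_apply_zero c, hx]
  | succ n ih =>
    have h := telescopeMap_apply_succ c x n
    rw [hx, ih] at h
    simpa using h.symm

/-- Modulo the range, eₙ equals c n • eₙ₊₁, so a vector can be pushed to any large index; allowing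
all n ≥ N lets two summands meet. -/
lemma exists_sub_single_mem_range_telescopeMap (x : ℕ →₀ R) :
    ∃ N, ∀ n ≥ N, ∃ r, x - Finsupp.single n r ∈ (telescopeMap c).range := by
  induction x using Finsupp.induction_linear with
  | zero => exact ⟨0, fun n _ => ⟨0, by simp⟩⟩
  | add x y hx hy =>
    obtain ⟨N, hN⟩ := hx
    obtain ⟨K, hK⟩ := hy
    refine ⟨max N K, fun n hn => ?_⟩
    obtain ⟨r, hr⟩ := hN n (le_of_max_le_left hn)
    obtain ⟨s, hs⟩ := hK n (le_of_max_le_right hn)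
    refine ⟨r + s, ?_⟩
    rw [Finsupp.single_add, add_sub_add_comm]
    exact add_mem hr hs
  | single k r =>
    refine ⟨k, fun n hn => ?_⟩
    induction n, hn using Nat.le_induction with
    | base => exact ⟨r, by simp⟩
    | succ n hn ih =>
      obtain ⟨s, hs⟩ := ih
      refine ⟨s * c n, ?_⟩
      convert add_mem hs ⟨Finsupp.single n s, rfl⟩ using 1
      rw [telescopeMap_single]
      abel

/-- A union of an increasing sequence of nonzero principal ideals has projective dimension at
most one. -/
theorem Ideal.hasProjectiveDimensionLE_one_of_chain [IsDomain R] (I : Ideal R) (a : ℕ → R)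
    (ha : ∀ n, a n ≠ 0) (hdvd : ∀ n, a (n + 1) ∣ a n) (hI : ∀ x, x ∈ I ↔ ∃ n, a n ∣ x) :
    HasProjectiveDimensionLE (ModuleCat.of R I) 1 := by
  choose c hc using hdvd
  let g : (ℕ →₀ R) →ₗ[R] I :=
    Finsupp.linearCombination R fun n => ⟨a n, (hI _).mpr ⟨n, dvd_rfl⟩⟩
  have hg (n : ℕ) (r : R) : (g (Finsupp.single n r) : R) = r * a n := by simp [g]
  have hcomp (x : ℕ →₀ R) : g (telescopeMap c x) = 0 := by
    induction x using Finsupp.induction_linear with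
    | zero => simp
    | add x y hx hy => rw [map_add, map_add, hx, hy, add_zero]
    | single n r =>
      apply Subtype.ext
      rw [telescopeMap_single, map_sub, AddSubgroupClass.coe_sub, hg, hg, hc n,
        ZeroMemClass.coe_zero]
      ring
  refine ModuleCat.hasProjectiveDimensionLE_succ_of_exact (f := telescopeMap c) (g := g)
    (fun x => ⟨fun hx => ?_, ?_⟩) (telescopeMap_injective c) ?_ 0
    (ModuleCat.hasProjectiveDimensionLE_of_projective _ _)
    (ModuleCat.hasProjectiveDimensionLE_of_projective _ _)
  -- Modulo the range x is r • e_N, whose image r * a N vanishes only for r = 0.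
  · obtain ⟨N, hN⟩ := exists_sub_single_mem_range_telescopeMap c x
    obtain ⟨r, y, hy⟩ := hN N le_rfl
    have h0 : r * a N = 0 := by
      rw [← hg]
      have := hcomp y
      rw [hy, map_sub, hx, zero_sub, neg_eq_zero] at this
      rw [this]; rfl
    have hr : r = 0 := (mul_eq_zero.mp h0).resolve_right (ha N)
    exact ⟨y, by simpa [hr] using hy⟩
  · rintro ⟨y, rfl⟩
    exact hcomp y
  · rintro ⟨x, hx⟩
    obtain ⟨n, r, rfl⟩ := (hI x).mp hx
    exact ⟨Finsupp.single n r, Subtype.ext (by rw [hg, mul_comm])⟩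

end Telescope

/-! ### Ideals exhausted by countably many principal ideals -/

section Countable

variable {R : Type u} [CommRing R] [IsDomain R]

/-- A nonzero ideal that is the union of a countable directed family of principal ideals has
projective dimension at most one. -/
theorem Ideal.hasProjectiveDimensionLE_one_of_countable (I : Ideal R) (S : Set R)
    (hS : S.Nonempty) (h0 : ∀ a ∈ S, a ≠ 0) (hle : ∀ a ∈ S, a ∈ I)
    (hcount : S.Countable)
    (hdir : ∀ a ∈ S, ∀ b ∈ S, ∃ d ∈ S, d ∣ a ∧ d ∣ b)
    (hI : ∀ x ∈ I, ∃ a ∈ S, a ∣ x) :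
    HasProjectiveDimensionLE (ModuleCat.of R I) 1 := by
  obtain ⟨b, rfl⟩ := hcount.exists_eq_range hS
  have hbS (n : ℕ) : b n ∈ Set.range b := ⟨n, rfl⟩
  choose! m hmS hm₁ hm₂ using hdir
  -- Each term is a common divisor of its predecessor and the next `b`, so the chain is cofinal in
  -- `S`.
  let a : ℕ → R := fun n => Nat.rec (b 0) (fun n x => m x (b (n + 1))) n
  have haS (n : ℕ) : a n ∈ Set.range b := by
    induction n with
    | zero => exact hbS 0
    | succ n ih => exact hmS _ ih _ (hbS _)
  have hab (n : ℕ) : a n ∣ b n := by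
    cases n with
    | zero => exact dvd_rfl
    | succ n => exact hm₂ _ (haS n) _ (hbS _)
  refine I.hasProjectiveDimensionLE_one_of_chain a (fun n => h0 _ (haS n))
    (fun n => hm₁ _ (haS n) _ (hbS _)) fun x => ⟨fun hx => ?_, ?_⟩
  · obtain ⟨_, ⟨n, rfl⟩, hn⟩ := hI x hx
    exact ⟨n, (hab n).trans hn⟩
  · rintro ⟨n, hn⟩
    exact I.mem_of_dvd hn (hle _ (haS n))

/-- Let `ι : k[X] → R` be such that every element of `R` is congruent to a polynomial modulo every
nonzero polynomial. An ideal `I` generated up to polynomial factors by an element with only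
countably many monic polynomial divisors has projective dimension at most one. -/
theorem Ideal.hasProjectiveDimensionLE_one_of_polynomial {k : Type*} [Field k] (ι : k[X] →+* R)
    (hι : Function.Injective ι) (happrox : ∀ s : k[X], s ≠ 0 → ∀ h : R, ∃ r y, h = ι r + ι s * y)
    (I : Ideal R) (d : R) (hd0 : d ≠ 0) (hd : d ∈ I)
    (hgen : ∀ h ∈ I, ∃ s : k[X], s ≠ 0 ∧ d ∣ ι s * h)
    (hcount : {s : k[X] | s.Monic ∧ ι s ∣ d}.Countable) :
    HasProjectiveDimensionLE (ModuleCat.of R I) 1 := by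
  classical
  -- The fractions d/s lying in I; taking s monic makes `S` countable.
  let S : Set R := {e | e ∈ I ∧ ∃ s : k[X], s.Monic ∧ ι s * e = d}
  have hι0 {s : k[X]} (hs : s ≠ 0) : ι s ≠ 0 := (map_ne_zero_iff ι hι).mpr hs
  have hC {a : k} (ha : a ≠ 0) : ι (Polynomial.C a⁻¹) * ι (Polynomial.C a) = 1 := by
    rw [← map_mul, ← Polynomial.C_mul, inv_mul_cancel₀ ha, Polynomial.C_1, map_one]
  have normalize {e : R} (he : e ∈ I) {s : k[X]} (hs : s ≠ 0) (hse : ι s * e = d) :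
      ∃ e' ∈ S, e' ∣ e := by
    have hl : s.leadingCoeff ≠ 0 := leadingCoeff_ne_zero.mpr hs
    refine ⟨ι (Polynomial.C s.leadingCoeff) * e, ⟨I.mul_mem_left _ he,
      s * Polynomial.C s.leadingCoeff⁻¹,
      monic_mul_leadingCoeff_inv hs, ?_⟩, ι (Polynomial.C s.leadingCoeff⁻¹), ?_⟩
    · rw [map_mul]
      linear_combination ι s * e * hC hl + hse
    · linear_combination - e * hC hl
  -- Only s is required nonzero, since t will also be a remainder, possibly 0.
  have coprime (s t : k[X]) (hs : s ≠ 0) : ∃ g u v a b : k[X], g ≠ 0 ∧ u ≠ 0 ∧ s = g * u ∧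
      t = g * v ∧ ι a * ι u + ι b * ι v = 1 := by
    have hg : EuclideanDomain.gcd s t ≠ 0 := fun h => hs (EuclideanDomain.gcd_eq_zero_iff.mp h).1
    obtain ⟨u, hu⟩ := EuclideanDomain.gcd_dvd_left s t
    obtain ⟨v, hv⟩ := EuclideanDomain.gcd_dvd_right s t
    have hab := EuclideanDomain.gcd_eq_gcd_ab s t
    refine ⟨_, u, v, EuclideanDomain.gcdA s t, EuclideanDomain.gcdB s t, hg,
      fun h => hs (by rw [hu, h, mul_zero]), hu, hv, ?_⟩
    rw [← map_mul, ← map_mul, ← map_add, ← map_one ι]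
    congr 1
    apply mul_left_cancel₀ hg
    linear_combination -hab - EuclideanDomain.gcdA s t * hu - EuclideanDomain.gcdB s t * hv
  refine I.hasProjectiveDimensionLE_one_of_countable S ⟨d, hd, 1, monic_one, by simp⟩ ?_
    (fun e he => he.1) ?_ ?_ ?_
  · rintro _ ⟨-, s, -, h⟩ rfl
    exact hd0 (by rw [← h, mul_zero])
  · refine (hcount.biUnion (t := fun s _ => {e | ι s * e = d}) fun s hs => ?_).mono ?_
    · refine Set.Subsingleton.countable fun e he e' he' => ?_
      exact mul_left_cancel₀ (hι0 hs.1.ne_zero) (Eq.trans he he'.symm)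
    · rintro e ⟨-, s, hs, h⟩
      exact Set.mem_biUnion (x := s) ⟨hs, e, h.symm⟩ h
  · rintro e₁ ⟨he₁, s, hs, h₁⟩ e₂ ⟨he₂, t, ht, h₂⟩
    obtain ⟨g, u, v, a, b, hg, hu, rfl, rfl, hab⟩ := coprime s t hs.ne_zero
    have hv : v ≠ 0 := right_ne_zero_of_mul ht.ne_zero
    have h : ι u * e₁ = ι v * e₂ := by
      apply mul_left_cancel₀ (hι0 hg)
      rw [map_mul] at h₁ h₂
      linear_combination h₁ - h₂
    -- With e₁ = d/(gu) and e₂ = d/(gv), Bézout puts d/(guv) = a e₂ + b e₁ in I.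
    have hve : ι v * (ι a * e₂ + ι b * e₁) = e₁ := by linear_combination e₁ * hab - ι a * h
    have hue : ι u * (ι a * e₂ + ι b * e₁) = e₂ := by linear_combination e₂ * hab + ι b * h
    obtain ⟨e, he, hdvd⟩ := normalize
      (I.add_mem (I.mul_mem_left (ι a) he₂) (I.mul_mem_left (ι b) he₁))
      (mul_ne_zero (mul_ne_zero hg hu) hv)
      (by rw [map_mul, mul_assoc, hve, h₁])
    exact ⟨e, he, hdvd.trans ⟨ι v, by rw [mul_comm, hve]⟩, hdvd.trans ⟨ι u, by rw [mul_comm, hue]⟩⟩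
  · intro h hh
    obtain ⟨s, hs, x, hx⟩ := hgen h hh
    -- Replacing x = s⁻¹-numerator of h/d by its remainder r gives h - dy = dr/s = dv/u, and Bézout
    -- puts d/u in I; it divides h.
    obtain ⟨r, y, rfl⟩ := happrox s hs x
    obtain ⟨g, u, v, a, b, hg, hu, rfl, rfl, hab⟩ := coprime s r hs
    have h₁ : ι u * (h - d * y) = d * ι v := by
      apply mul_left_cancel₀ (hι0 hg)
      simp only [map_mul] at hx
      linear_combination hx
    have h₂ : ι u * (ι a * d + ι b * (h - d * y)) = d := by
      linear_combination d * hab + ι b * h₁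
    obtain ⟨e, he, hdvd⟩ := normalize (I.add_mem (I.mul_mem_left (ι a) hd)
      (I.mul_mem_left (ι b) (I.sub_mem hh (I.mul_mem_right y hd)))) hu h₂
    refine ⟨e, he, hdvd.trans ⟨ι v + ι u * y, ?_⟩⟩
    apply mul_left_cancel₀ (hι0 hu)
    linear_combination h₁ - (ι v + ι u * y) * h₂

end Countable

end

/-! ### Residues of `H1` modulo polynomials in z -/

namespace GeneralizedDD

lemma differentiable_expEval (p : ℂ[X][T;T⁻¹]) : Differentiable ℂ fun w => expEval w p := by
  induction p using LaurentPolynomial.induction_on' with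
  | add p q hp hq =>
    simp only [map_add]
    exact hp.add hq
  | C_mul_T n φ =>
    simp only [map_mul, expEval_C, expEval_T, ← Complex.exp_int_mul]
    fun_prop

/-- The inclusion of `ℂ[z, σ, σ⁻¹]` into `ℋ₁`. -/
noncomputable def ofLaurent : ℂ[X][T;T⁻¹] →+* H1 :=
  (algebraMap ℂ[X][T;T⁻¹] RatField).codRestrict H1 fun p =>
    isGeneralizedDD_of_laurent p (differentiable_expEval p)

lemma ofLaurent_injective : Function.Injective ofLaurent := fun _ _ h =>
  IsFractionRing.injective ℂ[X][T;T⁻¹] RatField congr(($h : RatField))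

/-- The inclusion of `ℂ[z]` into `ℋ₁`. -/
noncomputable def ofPoly : ℂ[X] →+* H1 := ofLaurent.comp LaurentPolynomial.C

lemma C_injective : Function.Injective (LaurentPolynomial.C : ℂ[X] →+* ℂ[X][T;T⁻¹]) := by
  intro φ ψ h
  refine Polynomial.funext fun w => ?_
  rw [← expEval_C, h, expEval_C]

lemma ofPoly_injective : Function.Injective ofPoly := ofLaurent_injective.comp C_injective

/-- The last identity is known off the finite zero set of φ and extends by continuity. -/
lemma exists_ofPoly_mul (h : H1) : ∃ (p : ℂ[X][T;T⁻¹]) (φ : ℂ[X]) (f : ℂ → ℂ), φ ≠ 0 ∧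
    ofPoly φ * h = ofLaurent p ∧ Differentiable ℂ f ∧
    ∀ w, φ.eval w * f w = expEval w p := by
  obtain ⟨h, p, φ, hφ, rfl, f, hf, hfp⟩ := h
  refine ⟨p, φ, f, hφ, Subtype.ext (mul_div_cancel₀ _ (algebraMap_C_ne_zero hφ)), hf, ?_⟩
  refine congrFun (Continuous.ext_on (s := {w | φ.eval w ≠ 0}) ?_ ?_ ?_ ?_)
  · have : {w | φ.eval w ≠ 0} = {w | φ.IsRoot w}ᶜ := rfl
    rw [this]
    exact (Polynomial.finite_setOfPred_isRoot hφ).countable.dense_compl ℝ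
  · exact φ.continuous.mul hf.continuous
  · exact (differentiable_expEval p).continuous
  · intro w hw
    simp only [hfp w hw]
    field_simp [show eval w φ ≠ 0 from hw]

/-- Take c = q*(a): then (q* - c)/(w - a) is again entire, being `dslope f a` for the extension f of
q*. -/
lemma exists_eq_add_X_sub_C_mul (h : H1) (a : ℂ) :
    ∃ (c : ℂ) (y : H1), h = ofPoly (Polynomial.C c) + ofPoly (X - Polynomial.C a) * y := by
  obtain ⟨p, φ, f, hφ, hp, hf, hfp⟩ := exists_ofPoly_mul h
  have hX : (X - Polynomial.C a) ≠ 0 := X_sub_C_ne_zero a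
  let q : RatField := (h - ofPoly (Polynomial.C (f a)) : H1) / (ofPoly (X - Polynomial.C a) : H1)
  have hne : ((ofPoly (X - Polynomial.C a) : H1) : RatField) ≠ 0 := algebraMap_C_ne_zero hX
  have hφ' : ((ofPoly φ : H1) : RatField) ≠ 0 := algebraMap_C_ne_zero hφ
  have hq : IsGeneralizedDD q := by
    refine ⟨p - LaurentPolynomial.C (φ * Polynomial.C (f a)), φ * (X - Polynomial.C a),
      mul_ne_zero hφ hX, ?_, dslope f a, ?_, ?_⟩
    · have hp' : ((ofPoly φ : H1) : RatField) * h = algebraMap _ RatField p :=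
        congr(($hp : RatField))
      rw [map_sub, ← hp', map_mul, map_mul, map_mul, map_mul]
      change q = (ofPoly φ * (h : RatField) -
          (ofPoly φ : H1) * (ofPoly (Polynomial.C (f a)) : H1)) /
        ((ofPoly φ : H1) * (ofPoly (X - Polynomial.C a) : H1))
      rw [← mul_sub, mul_div_mul_left _ _ hφ']
      rfl
    · rw [← differentiableOn_univ, Complex.differentiableOn_dslope Filter.univ_mem]
      exact hf.differentiableOn
    · intro w hw
      have hw' : w - a ≠ 0 := by
        intro h0
        simp [h0] at hw
      have hw'' : φ.eval w ≠ 0 := fun h0 => hw (by simp [h0])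
      rw [dslope_of_ne _ (sub_ne_zero.mp hw'), slope_def_field]
      simp only [map_sub, expEval_C, ← hfp, eval_mul, eval_sub, eval_X, eval_C]
      field_simp
  refine ⟨f a, ⟨q, hq⟩, Subtype.ext ?_⟩
  change (h : RatField) = _ + _ * q
  rw [mul_div_cancel₀ _ hne]
  simp

lemma exists_eq_ofPoly_add_mul (s : ℂ[X]) (hs : s ≠ 0) (h : H1) :
    ∃ (r : ℂ[X]) (y : H1), h = ofPoly r + ofPoly s * y := by
  have key (M : Multiset ℂ) (h : H1) : ∃ (r : ℂ[X]) (y : H1),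
      h = ofPoly r + ofPoly (M.map fun a => X - Polynomial.C a).prod * y := by
    induction M using Multiset.induction_on generalizing h with
    | empty => exact ⟨0, h, by simp⟩
    | cons a M ih =>
      obtain ⟨c, y, rfl⟩ := exists_eq_add_X_sub_C_mul h a
      obtain ⟨r, z, rfl⟩ := ih y
      refine ⟨Polynomial.C c + (X - Polynomial.C a) * r, z, ?_⟩
      rw [Multiset.map_cons, Multiset.prod_cons, map_add, map_mul, map_mul]
      ring
  obtain ⟨r, y, rfl⟩ := key s.roots h
  have hl : s.leadingCoeff ≠ 0 := leadingCoeff_ne_zero.mpr hs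
  refine ⟨r, ofPoly (Polynomial.C s.leadingCoeff⁻¹) * y, ?_⟩
  have hprod := congr(ofPoly $((IsAlgClosed.splits s).eq_prod_roots))
  rw [map_mul] at hprod
  have h1 : ofPoly (Polynomial.C s.leadingCoeff) * ofPoly (Polynomial.C s.leadingCoeff⁻¹) = 1 := by
    rw [← map_mul, ← Polynomial.C_mul, mul_inv_cancel₀ hl, Polynomial.C_1, map_one]
  linear_combination - y * ofPoly (s.roots.map fun a => X - Polynomial.C a).prod * h1 -
    ofPoly (Polynomial.C s.leadingCoeff⁻¹) * y * hprod

/-! ### Zeros of exponential polynomials and divisors from ℂ[z] -/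

lemma expEval_eq_zero_of_dvd {p : ℂ[X][T;T⁻¹]} {a : ℂ}
    (h : ofPoly (X - Polynomial.C a) ∣ ofLaurent p) : expEval a p = 0 := by
  obtain ⟨y, hy⟩ := h
  obtain ⟨q, φ, f, hφ, hq, hf, hfq⟩ := exists_ofPoly_mul y
  have h1 : LaurentPolynomial.C φ * p = LaurentPolynomial.C (X - Polynomial.C a) * q := by
    apply ofLaurent_injective
    rw [map_mul, map_mul, ← hq, hy]
    change ofPoly φ * _ = ofPoly _ * _
    ring
  have h2 : (fun w => expEval w p) = fun w => (w - a) * f w := by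
    refine Continuous.ext_on (s := {w | φ.eval w ≠ 0}) ?_ ?_ ?_ ?_
    · have : {w | φ.eval w ≠ 0} = {w | φ.IsRoot w}ᶜ := rfl
      rw [this]
      exact (Polynomial.finite_setOfPred_isRoot hφ).countable.dense_compl ℝ
    · exact (differentiable_expEval p).continuous
    · exact (continuous_id.sub continuous_const).mul hf.continuous
    · intro w hw
      apply mul_left_cancel₀ hw
      have := congr(expEval w $h1)
      simp only [map_mul, expEval_C, ← hfq, eval_sub, eval_X, eval_C] at this
      linear_combination this
  simpa using congrFun h2 a

/-- The exponential function is transcendental over `ℂ(z)`. -/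
lemma exists_expEval_toLaurent_ne_zero {p : ℂ[X][X]} (hp : p ≠ 0) :
    ∃ w, expEval w (toLaurent p) ≠ 0 := by
  by_contra! h
  have heval (w : ℂ) : expEval w (toLaurent p) =
      (p.eval (Polynomial.C (Complex.exp w))).eval w := by
    rw [expEval, LaurentPolynomial.eval₂_toLaurent, ← coe_evalRingHom w,
      ← eval₂_at_apply (evalRingHom w)]
    simp
  -- By periodicity of exp, the polynomial p(z, e^w) in z vanishes at every w + 2πik.
  have hroot (w : ℂ) : p.eval (Polynomial.C (Complex.exp w)) = 0 := by
    refine Polynomial.eq_zero_of_infinite_isRoot _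
      ((Set.infinite_range_of_injective (f := fun k : ℤ => w + k * (2 * Real.pi * Complex.I))
        fun k l hkl => ?_).mono ?_)
    · have h0 : (2 * Real.pi * Complex.I : ℂ) ≠ 0 := Complex.two_pi_I_ne_zero
      simpa [h0] using hkl
    · rintro _ ⟨k, rfl⟩
      have := h (w + k * (2 * Real.pi * Complex.I))
      rwa [heval, Complex.exp_periodic.int_mul k w] at this
  -- As a polynomial in σ over ℂ[z], p now has every positive integer as a root.
  refine hp (Polynomial.eq_zero_of_infinite_isRoot _
    ((Set.infinite_range_of_injective (f := fun n : ℕ => Polynomial.C ((n : ℂ) + 1))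
      fun k l hkl => ?_).mono ?_))
  · simpa using Polynomial.C_injective hkl
  · rintro _ ⟨n, rfl⟩
    have := hroot (Complex.log (n + 1))
    rwa [Complex.exp_log (by exact_mod_cast n.succ_ne_zero)] at this

/-- Zeros of a nonzero entire function are isolated, and a discrete subset of ℂ is countable. -/
lemma countable_expEval_toLaurent_eq_zero {p : ℂ[X][X]} (hp : p ≠ 0) :
    {w | expEval w (toLaurent p) = 0}.Countable := by
  obtain ⟨w, hw⟩ := exists_expEval_toLaurent_ne_zero hp
  have ha : AnalyticOnNhd ℂ (fun w => expEval w (toLaurent p)) Set.univ :=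
    (differentiable_expEval (toLaurent p)).differentiableOn.analyticOnNhd isOpen_univ
  have := (mem_codiscrete'.mp (ha.preimage_zero_mem_codiscrete hw)).2
  refine (HereditarilyLindelofSpace.isLindelof _).countable_of_isDiscrete ?_
  convert this using 1
  ext w
  simp

/-- The inclusion of `ℂ[z, σ]` into `ℋ₁`. -/
noncomputable def ofPolyPoly : ℂ[X][X] →+* H1 := ofLaurent.comp toLaurent

lemma ofPolyPoly_C (φ : ℂ[X]) : ofPolyPoly (Polynomial.C φ) = ofPoly φ := by
  simp [ofPolyPoly, ofPoly]

lemma ofPolyPoly_injective : Function.Injective ofPolyPoly :=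
  ofLaurent_injective.comp toLaurent_injective

/-- A monic s is determined by its multiset of roots, here drawn from a countable set. -/
lemma countable_monic_dvd {p : ℂ[X][X]} (hp : p ≠ 0) :
    {s : ℂ[X] | s.Monic ∧ ofPoly s ∣ ofPolyPoly p}.Countable := by
  have : Countable {w // expEval w (toLaurent p) = 0} :=
    (countable_expEval_toLaurent_eq_zero hp).to_subtype
  refine (Set.countable_range fun M : Multiset {w // expEval w (toLaurent p) = 0} =>
    ((M.map Subtype.val).map fun a => X - Polynomial.C a).prod).mono ?_
  rintro s ⟨hs, hsp⟩
  have hZ (a : ℂ) (ha : a ∈ s.roots) : expEval a (toLaurent p) = 0 := expEval_eq_zero_of_dvd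
    ((map_dvd ofPoly (dvd_iff_isRoot.mpr (isRoot_of_mem_roots ha))).trans hsp)
  obtain ⟨M, hM⟩ : ∃ M : Multiset {w // expEval w (toLaurent p) = 0},
      M.map Subtype.val = s.roots := CanLift.prf (β := Multiset _) s.roots hZ
  refine ⟨M, ?_⟩
  have h := (IsAlgClosed.splits s).eq_prod_roots
  rw [hs.leadingCoeff, Polynomial.C_1, one_mul] at h
  simp only [hM]
  exact h.symm

/-! ### Ideals of `H1` up to polynomial factors -/

lemma exists_mul_eq_ofPolyPoly (h : H1) : ∃ (s : ℂ[X]) (n : ℤ) (q : ℂ[X][X]), s ≠ 0 ∧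
    ofPoly s * h * ofLaurent (T n) = ofPolyPoly q := by
  obtain ⟨p, φ, f, hφ, hp, -⟩ := exists_ofPoly_mul h
  obtain ⟨n, q, hq⟩ := exists_T_pow p
  exact ⟨φ, n, q, hφ, by rw [hp, ← map_mul, ← hq]; rfl⟩

lemma ofLaurent_T_mul (n : ℤ) : ofLaurent (T n) * ofLaurent (T (-n)) = 1 := by
  rw [← map_mul, ← T_add, add_neg_cancel, T_zero, map_one]

/-- Up to polynomial factors in `z`, every nonzero ideal of `ℋ₁` is generated by one element. -/
lemma exists_generator (I : Ideal H1) (hI : I ≠ ⊥) : ∃ p : ℂ[X][X], p ≠ 0 ∧ ofPolyPoly p ∈ I ∧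
    ∀ h ∈ I, ∃ s : ℂ[X], s ≠ 0 ∧ ofPolyPoly p ∣ ofPoly s * h := by
  have hex : ∃ n : ℕ, ∃ p : ℂ[X][X], p ≠ 0 ∧ ofPolyPoly p ∈ I ∧ p.natDegree = n := by
    obtain ⟨h, hhI, h0⟩ := Submodule.exists_mem_ne_zero_of_ne_bot hI
    obtain ⟨s, n, q, hs, hq⟩ := exists_mul_eq_ofPolyPoly h
    refine ⟨_, q, ?_, hq ▸ I.mul_mem_right _ (I.mul_mem_left _ hhI), rfl⟩
    rintro rfl
    have hT : ofLaurent (T n) ≠ 0 := left_ne_zero_of_mul_eq_one (ofLaurent_T_mul n)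
    rw [map_zero] at hq
    exact mul_ne_zero (mul_ne_zero ((map_ne_zero_iff _ ofPoly_injective).mpr hs) h0) hT hq
  classical
  -- An element of least σ-degree serves as generator, by pseudo-division over ℂ[z].
  obtain ⟨p, hp, hpI, hdeg⟩ := Nat.find_spec hex
  have hmin (q : ℂ[X][X]) (hq : ofPolyPoly q ∈ I) (hlt : q.natDegree < p.natDegree) : q = 0 := by
    by_contra h0
    exact Nat.find_min hex (hdeg ▸ hlt) ⟨q, h0, hq, rfl⟩
  have hl : p.leadingCoeff ≠ 0 := leadingCoeff_ne_zero.mpr hp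
  have hpoly (n : ℕ) : ∀ q : ℂ[X][X], q.natDegree < n → ofPolyPoly q ∈ I →
      ∃ s : ℂ[X], s ≠ 0 ∧ p ∣ Polynomial.C s * q := by
    induction n with
    | zero => intro q hq; omega
    | succ n ih =>
      intro q hqn hqI
      by_cases hlt : q.natDegree < p.natDegree
      · exact ⟨1, one_ne_zero, by simp [hmin q hqI hlt]⟩
      push Not at hlt
      -- In degree 0 cancelling leading terms lowers nothing, but p itself is then a polynomial in z
      -- and serves as the factor.
      by_cases hq0 : q.natDegree = 0
      · refine ⟨p.leadingCoeff, hl, ?_⟩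
        rw [eq_C_of_natDegree_eq_zero (by lia : p.natDegree = 0), leadingCoeff_C]
        exact dvd_mul_right _ _
      have hr : p.cancelLeads q = Polynomial.C p.leadingCoeff * q -
          Polynomial.C q.leadingCoeff * X ^ (q.natDegree - p.natDegree) * p := by
        rw [cancelLeads, Nat.sub_eq_zero_of_le hlt, pow_zero, mul_one]
      have hrI : ofPolyPoly (p.cancelLeads q) ∈ I := by
        rw [hr, map_sub, map_mul, map_mul]
        exact I.sub_mem (I.mul_mem_left _ hqI) (I.mul_mem_left _ hpI)
      have hrn := natDegree_cancelLeads_lt_of_natDegree_le_natDegree hlt (Nat.pos_of_ne_zero hq0)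
      obtain ⟨s, hs, hdvd⟩ := ih _ (by lia) hrI
      refine ⟨s * p.leadingCoeff, mul_ne_zero hs hl, ?_⟩
      convert dvd_add hdvd (dvd_mul_left p (Polynomial.C s *
        (Polynomial.C q.leadingCoeff * X ^ (q.natDegree - p.natDegree)))) using 1
      rw [hr, Polynomial.C_mul]
      ring
  refine ⟨p, hp, hpI, fun h hh => ?_⟩
  obtain ⟨s, n, q, hs, hq⟩ := exists_mul_eq_ofPolyPoly h
  obtain ⟨t, ht, x, hx⟩ := hpoly _ q (Nat.lt_succ_self _)
    (hq ▸ I.mul_mem_right _ (I.mul_mem_left _ hh))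
  refine ⟨t * s, mul_ne_zero ht hs, ofPolyPoly x * ofLaurent (T (-n)), ?_⟩
  have hx' := congr(ofPolyPoly $hx)
  rw [map_mul, map_mul, ofPolyPoly_C, ← hq] at hx'
  rw [map_mul]
  linear_combination ofLaurent (T (-n)) * hx' - ofPoly t * ofPoly s * h * ofLaurent_T_mul n

lemma hasProjectiveDimensionLE_ideal (I : Ideal H1) :
    HasProjectiveDimensionLE (ModuleCat.of H1 I) 1 := by
  by_cases hI : I = ⊥
  · subst hI
    have : Subsingleton (⊥ : Ideal H1) := Submodule.uniqueBot.instSubsingleton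
    have : Module.Free H1 (⊥ : Ideal H1) := Module.Free.of_subsingleton _ _
    have : Module.Projective H1 (⊥ : Ideal H1) := Module.Projective.of_free
    exact ModuleCat.hasProjectiveDimensionLE_of_projective _ _
  obtain ⟨p, hp, hpI, hgen⟩ := exists_generator I hI
  exact I.hasProjectiveDimensionLE_one_of_polynomial ofPoly ofPoly_injective
    exists_eq_ofPoly_add_mul (ofPolyPoly p) ((map_ne_zero_iff _ ofPolyPoly_injective).mpr hp) hpI
    hgen (countable_monic_dvd hp)

end GeneralizedDD

theorem mainTheorem5 (n : ℕ) (hn : 1 ≤ n) :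
    GeneralizedDD.globalDimension.{v} (GeneralizedDD.H n) ≤ ((n + 1 : ℕ) : WithBot ℕ∞) := by
  refine iSup_le fun M => (projectiveDimension_le_iff M (n + 1)).mpr ?_
  have h := ModuleCat.hasProjectiveDimensionLE_mvPolynomial.{v} (R := GeneralizedDD.H1) 2
    (ModuleCat.hasProjectiveDimensionLE_succ_of_ideal 1
      GeneralizedDD.hasProjectiveDimensionLE_ideal) (n - 1) M
  rwa [show 2 + (n - 1) = n + 1 by omega] at h
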